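/- Consider the incremental algorithm $G$ that computes the Delaunay triangulation of a sequence of planar points by inserting them one by one. To insert a new point $p$, it walks from the most recently inserted point straight towards $p$ through the current triangulation until it reaches the triangle containing $p$ (each crossing of an edge is one navigation operation); it joins $p$ to the three vertices of that triangle; and it then flips the edges that violate the empty-circumcircle condition until no invalid edge is left (each flip is one flip operation). Here the exterior of the convex hull is also triangulated, by joining every edge of the hull to a vertex at infinity. The region of the triangle on the hull edge $ab$ and the vertex at infinity is the open half-plane beyond $ab$, which also plays the role of the interior of its circumcircle; the initial structure on two points consists of their segment and its two half-planes. For an integer $k>0$, a sequence of points is $k$-D-linear if $G$, run on it, performs at most $k$ navigation operations and at most $k$ flips for each point. A $k$-D-linear run of a sequence $S$ is a nonempty $k$-D-linear subsequence of consecutive points of $S$. Test-and-divide partitioning of a sequence $\langle p_1,\dots,p_n\rangle$ returns it as a single run if it is $k$-D-linear, and otherwise recursively partitions $\langle p_1,\dots,p_{\lfloor n/2\rfloor}\rangle$ and $\langle p_{\lfloor n/2\rfloor+1},\dots,p_n\rangle$. Theorem. For every fixed integer $k>0$ there are sequences $S_n$ ($n\ge 0$) such that $S_n$ consists of $n$ distinct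 planar points, no three of them collinear; test-and-divide partitioning of $S_n$ yields $\Theta(n)$ $k$-D-linear runs as $n\to\infty$ (the constants may depend on $k$); and, for all sufficiently large $n$, the minimum number of runs in a partition of $S_n$ into $k$-D-linear runs is exactly $2$. -/

import Mathlib

open Filter Asymptotics

namespace IncrementalDelaunay

noncomputable section

/-- The plane, with its Cartesian coordinates. -/
abbrev Plane : Type := ℝ × ℝ

/-- The orientation test: positive iff `a, b, c` make a left turn, i.e. iff `c` lies strictly to
the left of the line directed from `a` to `b`; zero iff the three points are collinear. -/
def orient (a b c : Plane) : ℝ :=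
  (b.1 - a.1) * (c.2 - a.2) - (b.2 - a.2) * (c.1 - a.1)

/-- The incircle test: for a counterclockwise triangle `a, b, c`, positive iff `p` lies strictly
inside its circumcircle. -/
def inCircle (a b c p : Plane) : ℝ :=
  Matrix.det !![a.1 - p.1, a.2 - p.2, (a.1 - p.1) ^ 2 + (a.2 - p.2) ^ 2;
                b.1 - p.1, b.2 - p.2, (b.1 - p.1) ^ 2 + (b.2 - p.2) ^ 2;
                c.1 - p.1, c.2 - p.2, (c.1 - p.1) ^ 2 + (c.2 - p.2) ^ 2]

/-- A vertex of the structure: a point of the plane, or the vertex at infinity `none`. -/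
abbrev Vertex : Type := Option Plane

/-- An oriented triangle. A triangle of three points is listed counterclockwise. A triangle
`(a, b, none)` is the unbounded region beyond the edge `a b` of the convex hull, where `a, b` are
listed so that this region lies to the left of the line directed from `a` to `b`. -/
abbrev Triangle : Type := Vertex × Vertex × Vertex

/-- The three cyclic listings of one oriented triangle. -/
def cyc (a b c : Vertex) : Set Triangle := {(a, b, c), (b, c, a), (c, a, b)}

/-- The structure maintained by the incremental algorithm: the set of all listings of all its
triangles, including the unbounded ones. -/
abbrev Mesh : Type := Set Triangle

/-- `p` lies in the open region of the plane that belongs to the given triangle. -/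
def Contains : Triangle → Plane → Prop
  | (some a, some b, some c), p => 0 < orient a b p ∧ 0 < orient b c p ∧ 0 < orient c a p
  | (some a, some b, none), p => 0 < orient a b p
  | (none, some a, some b), p => 0 < orient a b p
  | (some b, none, some a), p => 0 < orient a b p
  | _, _ => False

/-- `p` violates the empty-circle condition of the given triangle: `p` is strictly inside its
circumcircle, which for an unbounded triangle is the open half-plane beyond its hull edge. -/
def Conflict : Triangle → Plane → Prop
  | (some a, some b, some c), p => 0 < inCircle a b c p
  | (some a, some b, none), p => 0 < orient a b p
  | (none, some a, some b), p => 0 < orient a b p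
  | (some b, none, some a), p => 0 < orient a b p
  | _, _ => False

/-- The structure on the first two points: their segment, with an unbounded region on each side. -/
def initialMesh (a b : Plane) : Mesh :=
  cyc (some a) (some b) none ∪ cyc (some b) (some a) none

/-- The segment from `q` to `p` leaves a triangle that has the counterclockwise edge `x y`
through that edge: `p` is on the wrong side of `x y`, and `x`, `y` are on the right and on the left
of the line directed from `q` to `p`. -/
def Exits (q p x y : Plane) : Prop :=
  orient x y p < 0 ∧ orient q p x < 0 ∧ 0 < orient q p y

/-- `Walk T q p t m`: walking in the mesh `T` from the vertex `q` straight in the direction of `p`,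
one reaches the triangle `t` after `m` navigation operations (crossings of an edge). The walk starts
in the triangle at `q` that lies in the direction of `p`. -/
inductive Walk (T : Mesh) (q p : Plane) : Triangle → ℕ → Prop
  | start_inside {a b : Plane} :
      (some q, some a, some b) ∈ T → 0 < orient q a p → 0 < orient q p b →
      Walk T q p (some q, some a, some b) 0
  | start_outside {a b : Plane} :
      (some a, some b, none) ∈ T → a = q ∨ b = q → 0 < orient a b p →
      Walk T q p (some a, some b, none) 0
  | cross {x y z d : Vertex} {a b : Plane} {c : Vertex} {m : ℕ} :
      Walk T q p (x, y, z) m → (some a, some b, c) ∈ cyc x y z → Exits q p a b →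
      (some b, some a, d) ∈ T → Walk T q p (some b, some a, d) (m + 1)

/-- Insertion of `p` in the interior of the triangle `a b c`: three new edges join `p` to the
vertices of the triangle. -/
def split (T : Mesh) (p : Plane) (a b c : Vertex) : Mesh :=
  (T \ cyc a b c) ∪ cyc (some p) a b ∪ cyc (some p) b c ∪ cyc (some p) c a

/-- The flip of the edge `a b` between the triangles `p a b` and `b a c`: it is replaced by the
edge `p c`. -/
def flipEdge (T : Mesh) (p : Plane) (a b c : Vertex) : Mesh :=
  (T \ (cyc (some p) a b ∪ cyc b a c)) ∪ cyc (some p) a c ∪ cyc (some p) c b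

/-- `Legalize p T a b f T'`: restoring the empty-circle condition at the edge `a b` of the triangle
`p a b`, and recursively at the edges that this affects, leads from `T` to `T'` with exactly `f`
flips. -/
inductive Legalize (p : Plane) : Mesh → Vertex → Vertex → ℕ → Mesh → Prop
  | valid {T : Mesh} {a b c : Vertex} :
      (b, a, c) ∈ T → ¬ Conflict (b, a, c) p → Legalize p T a b 0 T
  | flip {T T₁ T₂ : Mesh} {a b c : Vertex} {f g : ℕ} :
      (b, a, c) ∈ T → Conflict (b, a, c) p →
      Legalize p (flipEdge T p a b c) a c f T₁ → Legalize p T₁ c b g T₂ →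
      Legalize p T a b (f + g + 1) T₂

/-- `Insertion T q p m f T'`: one round of the incremental algorithm, which starts at the most
recently inserted point `q`, locates the new point `p` with `m` navigation operations, joins it to
the triangle containing it, and performs `f` flips to turn `T` into `T'`. -/
def Insertion (T : Mesh) (q p : Plane) (m f : ℕ) (T' : Mesh) : Prop :=
  ∃ (a b c : Vertex) (T₁ T₂ : Mesh) (f₁ f₂ f₃ : ℕ),
    Walk T q p (a, b, c) m ∧ Contains (a, b, c) p ∧
    Legalize p (split T p a b c) a b f₁ T₁ ∧
    Legalize p T₁ b c f₂ T₂ ∧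
    Legalize p T₂ c a f₃ T' ∧
    f = f₁ + f₂ + f₃

/-- Started from the mesh `T` with most recent point `q`, the incremental algorithm inserts the
points of the list in order, with at most `k` navigation operations and at most `k` flips for each
of them. -/
def InsertsWithin (k : ℕ) : Mesh → Plane → List Plane → Prop
  | _, _, [] => True
  | T, q, p :: S =>
      ∃ (m f : ℕ) (T' : Mesh), Insertion T q p m f T' ∧ m ≤ k ∧ f ≤ k ∧ InsertsWithin k T' p S

/-- A sequence of points is `k`-D-linear: the incremental algorithm, run on it, performs at most
`k` navigation operations and at most `k` flips for each point. Building the initial structure on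
the first two points needs none. -/
def DLinear (k : ℕ) : List Plane → Prop
  | a :: b :: S => InsertsWithin k (initialMesh a b) b S
  | _ => True

theorem DLinear.of_length_le_one {k : ℕ} {S : List Plane} (h : S.length ≤ 1) : DLinear k S := by
  match S, h with
  | [], _ => trivial
  | [_], _ => trivial

open Classical in
/-- Test-and-divide partitioning: a `k`-D-linear sequence is one run; any other sequence is cut
into its first `⌊n/2⌋` points and the remaining ones, and both parts are treated recursively. The
result is the list of the runs. -/
def testAndDivide (k : ℕ) (S : List Plane) : List (List Plane) :=
  if h : DLinear k S then [S]
  else testAndDivide k (S.take (S.length / 2)) ++ testAndDivide k (S.drop (S.length / 2))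
termination_by S.length
decreasing_by
  all_goals
    have h2 : ¬ S.length ≤ 1 := fun h' => h (DLinear.of_length_le_one h')
    simp only [List.length_take, List.length_drop]
    omega

/-- `P` is a partition of the sequence `S` into (nonempty, consecutive) `k`-D-linear runs. -/
def IsRunPartition (k : ℕ) (S : List Plane) (P : List (List Plane)) : Prop :=
  P.flatten = S ∧ ∀ R ∈ P, R ≠ [] ∧ DLinear k R

/-- The points are pairwise distinct and no three of them are collinear. -/
def GeneralPosition (S : List Plane) : Prop :=
  S.Nodup ∧ ∀ a ∈ S, ∀ b ∈ S, ∀ c ∈ S, a ≠ b → b ≠ c → a ≠ c →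
    ¬ Collinear ℝ ({a, b, c} : Set Plane)

end

end IncrementalDelaunay

/-! All points lie on the parabola `y = x ^ 2` with positive abscissas. There both geometric tests
depend only on the order of the abscissas, and the Delaunay triangulation is a fan around the
leftmost point. A decreasing sequence replaces the apex at every insertion, so the whole fan is
flipped and a run has at most `k + 3` points (`le_of_dLinear_parabolaPrefix`). If the minimum is
inserted first and the rest decreases, the apex stays and no insertion needs a crossing or a flip
(`dLinear_cons_of_pairwise_gt`). The sequence consists of two decreasing blocks, the lower one
first. The lower block has `m + 1` points, where `m` is the length of a `k`-D-linear prefix that one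
more point spoils. Cutting just before the minimum, at index `m`, gives two runs, and one run is
impossible. For large `n`, halving cuts beyond index `m`; the second half is decreasing without the
minimum and breaks into linearly many runs. -/

namespace IncrementalDelaunay

/-! ### Orientation, incircle test and general position on the parabola -/

/-- The point of the parabola `y = x ^ 2` with the given abscissa. -/
def parabola (x : ℝ) : Plane := (x, x ^ 2)

theorem parabola_injective : Function.Injective parabola := fun _ _ h => congrArg Prod.fst h

theorem orient_parabola (a b c : ℝ) :
    orient (parabola a) (parabola b) (parabola c) = (b - a) * (c - a) * (c - b) := by
  simp only [orient, parabola]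
  ring

/-- A circle meets the parabola in the roots of a quartic without cubic term, whence the factor `a +
b + c + p`. For positive abscissas it is positive, and only the order matters. -/
theorem inCircle_parabola (a b c p : ℝ) :
    inCircle (parabola a) (parabola b) (parabola c) (parabola p) =
      (b - a) * (c - a) * (c - b) * ((a - p) * (b - p) * (c - p)) * (a + b + c + p) := by
  simp only [inCircle, parabola, Matrix.det_fin_three, Matrix.of_apply, Matrix.cons_val]
  ring

theorem orient_eq_zero_of_collinear {a b c : Plane} (h : Collinear ℝ ({a, b, c} : Set Plane)) :
    orient a b c = 0 := by
  obtain ⟨v, hv⟩ := (collinear_iff_of_mem (p₀ := a) (by simp)).1 h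
  obtain ⟨r, hr⟩ := hv b (by simp)
  obtain ⟨s, hs⟩ := hv c (by simp)
  subst hr hs
  simp [orient]
  ring

theorem generalPosition_map_parabola {l : List ℝ} (h : l.Nodup) :
    GeneralPosition (l.map parabola) := by
  refine ⟨h.map parabola_injective, ?_⟩
  intro a ha b hb c hc hab hbc hac hcol
  obtain ⟨x, -, rfl⟩ := List.mem_map.1 ha
  obtain ⟨y, -, rfl⟩ := List.mem_map.1 hb
  obtain ⟨z, -, rfl⟩ := List.mem_map.1 hc
  have h0 := orient_eq_zero_of_collinear hcol
  rw [orient_parabola] at h0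
  rw [parabola_injective.ne_iff] at hab hbc hac
  exact mul_ne_zero (mul_ne_zero (sub_ne_zero.2 hab.symm) (sub_ne_zero.2 hac.symm))
    (sub_ne_zero.2 hbc.symm) h0

theorem orient_parabola_pos {a b c : ℝ} (hab : a < b) (hbc : b < c) :
    0 < orient (parabola a) (parabola b) (parabola c) := by
  rw [orient_parabola]
  exact mul_pos (mul_pos (sub_pos.2 hab) (sub_pos.2 (hab.trans hbc))) (sub_pos.2 hbc)

theorem orient_rotate (a b c : Plane) : orient a b c = orient b c a := by
  simp only [orient]; ring

theorem orient_swap (a b c : Plane) : orient a b c = -orient b a c := by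
  simp only [orient]; ring

/-! ### Runs of the algorithm in general -/

theorem InsertsWithin.of_append {k : ℕ} {A B : List Plane} {T : Mesh} {q : Plane}
    (h : InsertsWithin k T q (A ++ B)) : InsertsWithin k T q A := by
  induction A generalizing T q with
  | nil => trivial
  | cons a A ih =>
    obtain ⟨m, f, T', h1, h2, h3, h4⟩ := h
    exact ⟨m, f, T', h1, h2, h3, ih h4⟩

theorem DLinear.of_append {k : ℕ} {A B : List Plane} (h : DLinear k (A ++ B)) : DLinear k A := by
  match A, h with
  | [], _ => trivial
  | [_], _ => trivial
  | _ :: _ :: _, h => exact InsertsWithin.of_append h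

theorem Walk.mem {T : Mesh} {q p : Plane} {t : Triangle} {m : ℕ} (h : Walk T q p t m) :
    t ∈ T := by
  cases h <;> assumption

theorem Legalize.eq_of_not_conflict {p : Plane} {T T' : Mesh} {a b : Vertex} {f : ℕ}
    (h : Legalize p T a b f T') (hc : ∀ c, (b, a, c) ∈ T → ¬ Conflict (b, a, c) p) : T' = T := by
  cases h with
  | valid => rfl
  | flip h1 h2 => exact absurd h2 (hc _ h1)

/-! ### A decreasing sequence above its first point -/

/-- The part of the mesh around the hull edge from `q` to `g` that the insertion of a point of the
parabola between them depends on. -/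
structure Ready (T : Mesh) (g q : ℝ) : Prop where
  outside : (some (parabola q), some (parabola g), none) ∈ T
  inside : ∃ c, (some (parabola g), some (parabola q), c) ∈ T ∧
    ∀ p, g < p → p < q → ¬ Conflict (some (parabola g), some (parabola q), c) (parabola p)
  left : ∃ c, (none, some (parabola g), c) ∈ T ∧
    ∀ p, g < p → p < q → ¬ Conflict (none, some (parabola g), c) (parabola p)
  right : ∃ c, (some (parabola q), none, c) ∈ T ∧
    ∀ p, g < p → p < q → ¬ Conflict (some (parabola q), none, c) (parabola p)

theorem not_orient_parabola_pos {a b p : ℝ} (h : a < p) (h' : p < b) :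
    ¬ 0 < orient (parabola a) (parabola b) (parabola p) := by
  have := orient_parabola_pos h h'
  rw [orient_rotate, orient_rotate, orient_swap] at this
  linarith

theorem not_orient_parabola_pos_of_lt {a b p : ℝ} (h : p < a) (h' : a < b) :
    ¬ 0 < orient (parabola b) (parabola a) (parabola p) := by
  have := orient_parabola_pos h h'
  rw [orient_swap, ← orient_rotate]
  linarith

theorem ready_initialMesh {g q : ℝ} : Ready (initialMesh (parabola g) (parabola q)) g q where
  outside := by simp [initialMesh, cyc]
  inside := ⟨none, by simp [initialMesh, cyc], fun _ => not_orient_parabola_pos⟩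
  left := ⟨some (parabola q), by simp [initialMesh, cyc], fun _ => not_orient_parabola_pos⟩
  right := ⟨some (parabola g), by simp [initialMesh, cyc], fun _ => not_orient_parabola_pos⟩

/-- The new point lies beyond the hull edge from `q` to `g`, where the walk starts. The triangle `g
p q` joins the fan around `g`, and the situation recurs with `p` in place of `q`. -/
theorem Ready.insertion {T : Mesh} {g q p : ℝ} (hT : Ready T g q) (h0 : 0 < g) (hg : g < p)
    (hq : p < q) : ∃ T', Insertion T (parabola q) (parabola p) 0 0 T' ∧ Ready T' g p := by
  obtain ⟨ho, ⟨c₁, h1, h1'⟩, ⟨c₂, h2, h2'⟩, ⟨c₃, h3, h3'⟩⟩ := hT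
  have hp : 0 < orient (parabola q) (parabola g) (parabola p) := by
    rw [orient_rotate]; exact orient_parabola_pos hg hq
  have hgq : parabola g ≠ parabola q := parabola_injective.ne (hg.trans hq).ne
  refine ⟨split T (parabola p) (some (parabola q)) (some (parabola g)) none, ?_, ?_⟩
  · refine ⟨_, _, _, _, _, 0, 0, 0, .start_outside ho (.inl rfl) hp, hp,
      .valid (c := c₁) ?_ (h1' p hg hq), .valid (c := c₂) ?_ (h2' p hg hq),
      .valid (c := c₃) ?_ (h3' p hg hq), rfl⟩
    · simp [split, cyc, h1, hgq]
    · simp [split, cyc, h2, hgq]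
    · simp [split, cyc, h3, hgq.symm]
  · refine ⟨by simp [split, cyc], ⟨some (parabola q), by simp [split, cyc], ?_⟩,
      ⟨c₂, by simp [split, cyc, h2, hgq], fun r hr hrp => h2' r hr (hrp.trans hq)⟩,
      ⟨some (parabola q), by simp [split, cyc], ?_⟩⟩
    -- Since `g < r < p < q`, exactly one of the three differences with `r` is negative.
    · intro r hr hrp
      simp only [Conflict, inCircle_parabola, not_lt]
      refine mul_nonpos_of_nonpos_of_nonneg (mul_nonpos_of_nonneg_of_nonpos ?_ ?_) ?_
      · exact mul_nonneg (mul_nonneg (by linarith) (by linarith)) (by linarith)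
      · exact mul_nonpos_of_nonpos_of_nonneg
          (mul_nonpos_of_nonpos_of_nonneg (by linarith) (by linarith)) (by linarith)
      · linarith
    · exact fun r _ hrp => not_orient_parabola_pos_of_lt hrp hq

theorem Ready.insertsWithin {k : ℕ} {l : List ℝ} {T : Mesh} {g q : ℝ} (hT : Ready T g q)
    (h0 : 0 < g) (hl : (q :: l).Pairwise (· > ·)) (hg : ∀ x ∈ l, g < x) :
    InsertsWithin k T (parabola q) (l.map parabola) := by
  induction l generalizing T q with
  | nil => trivial
  | cons p l ih =>
    obtain ⟨hq, hl⟩ := List.pairwise_cons.1 hl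
    obtain ⟨T', hins, hT'⟩ := hT.insertion h0 (hg p (by simp)) (hq p (by simp))
    exact ⟨0, 0, T', hins, k.zero_le, k.zero_le,
      ih hT' hl fun x hx => hg x (List.mem_cons_of_mem _ hx)⟩

theorem dLinear_cons_of_pairwise_gt {k : ℕ} {g : ℝ} {l : List ℝ} (h0 : 0 < g)
    (hl : l.Pairwise (· > ·)) (hg : ∀ x ∈ l, g < x) : DLinear k ((g :: l).map parabola) := by
  match l with
  | [] => trivial
  | q :: l =>
    exact ready_initialMesh.insertsWithin h0 hl fun x hx => hg x (List.mem_cons_of_mem _ hx)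

/-! ### A decreasing sequence -/

section Decreasing

variable {x : ℕ → ℝ}

/-- The vertex with index `i` of a sequence on the parabola. -/
def vertex (x : ℕ → ℝ) (i : ℕ) : Vertex := some (parabola (x i))

/-- The Delaunay triangulation of the points with indices `0, …, n` of a decreasing sequence on the
parabola: a fan around the last point. -/
def Fan (x : ℕ → ℝ) (n : ℕ) : Mesh :=
  {t | (∃ i, i + 1 < n ∧ t ∈ cyc (vertex x n) (vertex x (i + 1)) (vertex x i)) ∨
    (∃ i < n, t ∈ cyc (vertex x i) (vertex x (i + 1)) none) ∨
    t ∈ cyc (vertex x n) (vertex x 0) none}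

/-- The mesh that is reached from the triangulation of the points with indices `0, …, n` during the
insertion of the next point, after `j` flips. -/
def Flipping (x : ℕ → ℝ) (n j : ℕ) : Mesh :=
  {t | (∃ i, j ≤ i ∧ i + 1 < n ∧ t ∈ cyc (vertex x n) (vertex x (i + 1)) (vertex x i)) ∨
    (∃ i < j, t ∈ cyc (vertex x (n + 1)) (vertex x (i + 1)) (vertex x i)) ∨
    t ∈ cyc (vertex x (n + 1)) (vertex x n) (vertex x j) ∨
    (∃ i < n + 1, t ∈ cyc (vertex x i) (vertex x (i + 1)) none) ∨
    t ∈ cyc (vertex x (n + 1)) (vertex x 0) none}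

theorem vertex_inj (hx : StrictAnti x) {i j : ℕ} : vertex x i = vertex x j ↔ i = j := by
  simp [vertex, parabola_injective.eq_iff, hx.injective.eq_iff]

theorem vertex_ne_none (i : ℕ) : vertex x i ≠ none := by simp [vertex]

theorem none_ne_vertex (i : ℕ) : none ≠ vertex x i := by simp [vertex]

/-- Only inclusions of meshes are tracked: the flip count needs no more than that no other triangles
occur, as a derivation of `Legalize` itself supplies those it uses. -/
theorem initialMesh_subset_fan :
    initialMesh (parabola (x 0)) (parabola (x 1)) ⊆ Fan x 1 := by
  rintro t (ht | ht)
  · exact .inr (.inl ⟨0, one_pos, ht⟩)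
  · exact .inr (.inr ht)

theorem flipping_subset_fan (n : ℕ) : Flipping x (n + 1) n ⊆ Fan x (n + 2) := by
  rintro t (⟨i, h, h', -⟩ | ⟨i, h, ht⟩ | ht | ⟨i, h, ht⟩ | ht)
  · omega
  · exact .inl ⟨i, by omega, ht⟩
  · exact .inl ⟨n, by omega, ht⟩
  · exact .inr (.inl ⟨i, h, ht⟩)
  · exact .inr (.inr ht)

theorem cyc_rotate (a b c : Vertex) : cyc b c a = cyc a b c := by
  ext t
  simp only [cyc, Set.mem_insert_iff, Set.mem_singleton_iff]
  tauto

theorem split_rotate (T : Mesh) (p : Plane) (a b c : Vertex) :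
    split T p b c a = split T p a b c := by
  ext t
  simp only [split, cyc_rotate a b c, Set.mem_union, Set.mem_sdiff]
  tauto

theorem split_fan_subset {T : Mesh} {n : ℕ} (hT : T ⊆ Fan x n) :
    split T (parabola (x (n + 1))) (vertex x n) (vertex x 0) none ⊆ Flipping x n 0 := by
  rintro t (((⟨ht, hn⟩ | ht) | ht) | ht)
  · rcases hT ht with ⟨i, h, ht⟩ | ⟨i, h, ht⟩ | ht
    · exact .inl ⟨i, i.zero_le, h, ht⟩
    · exact .inr (.inr (.inr (.inl ⟨i, by omega, ht⟩)))
    · exact absurd ht hn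
  · exact .inr (.inr (.inl ht))
  · exact .inr (.inr (.inr (.inr ht)))
  · refine .inr (.inr (.inr (.inl ⟨n, by omega, ?_⟩)))
    rwa [cyc_rotate] at ht

theorem flipEdge_flipping_subset {T : Mesh} {n j : ℕ} (hT : T ⊆ Flipping x n j) :
    flipEdge T (parabola (x (n + 1))) (vertex x n) (vertex x j) (vertex x (j + 1)) ⊆
      Flipping x n (j + 1) := by
  rintro t ((⟨ht, hn⟩ | ht) | ht)
  · rcases hT ht with ⟨i, h, h', ht⟩ | ⟨i, h, ht⟩ | ht | ⟨i, h, ht⟩ | ht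
    · rcases h.eq_or_lt with rfl | h
      · refine absurd (.inr ?_) hn
        rwa [← cyc_rotate, ← cyc_rotate] at ht
      · exact .inl ⟨i, h, h', ht⟩
    · exact .inr (.inl ⟨i, by omega, ht⟩)
    · exact absurd (.inl ht) hn
    · exact .inr (.inr (.inr (.inl ⟨i, h, ht⟩)))
    · exact .inr (.inr (.inr (.inr ht)))
  · exact .inr (.inr (.inl ht))
  · exact .inr (.inl ⟨j, by omega, ht⟩)

/-- The mesh determines the triangle across each edge to be legalized, so `Legalize` has no choice
of neighbour here or in the next three lemmas. -/
theorem eq_of_mem_flipping_inside (hx : StrictAnti x) {n j : ℕ} {c : Vertex} (hj : j + 1 < n)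
    (h : (vertex x j, vertex x n, c) ∈ Flipping x n j) : c = vertex x (j + 1) := by
  simp only [Flipping, cyc, Set.mem_ofPred_eq, Set.mem_insert_iff, Set.mem_singleton_iff,
    Prod.mk.injEq, vertex_inj hx, vertex_ne_none] at h
  grind

theorem eq_of_mem_flipping_edge (hx : StrictAnti x) {n j i : ℕ} {c : Vertex} (hj : j < n)
    (hi : i < j ∨ i + 1 = n)
    (h : (vertex x i, vertex x (i + 1), c) ∈ Flipping x n j) : c = none := by
  simp only [Flipping, cyc, Set.mem_ofPred_eq, Set.mem_insert_iff, Set.mem_singleton_iff,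
    Prod.mk.injEq, vertex_inj hx, vertex_ne_none] at h
  grind

theorem eq_of_mem_flipping_none_zero (hx : StrictAnti x) {n j : ℕ} {c : Vertex}
    (h : (none, vertex x 0, c) ∈ Flipping x n j) : c = vertex x 1 := by
  simp only [Flipping, cyc, Set.mem_ofPred_eq, Set.mem_insert_iff, Set.mem_singleton_iff,
    Prod.mk.injEq, vertex_inj hx, vertex_ne_none, none_ne_vertex] at h
  grind

theorem eq_of_mem_flipping_last_none (hx : StrictAnti x) {n j : ℕ} {c : Vertex}
    (h : (vertex x (n + 1), none, c) ∈ Flipping x (n + 1) j) : c = vertex x n := by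
  simp only [Flipping, cyc, Set.mem_ofPred_eq, Set.mem_insert_iff, Set.mem_singleton_iff,
    Prod.mk.injEq, vertex_inj hx, vertex_ne_none, none_ne_vertex] at h
  grind

theorem legalize_hull_start (hx : StrictAnti x) {n j f : ℕ} {T T' : Mesh}
    (hT : T ⊆ Flipping x (n + 1) j)
    (h : Legalize (parabola (x (n + 2))) T (vertex x 0) none f T') : T' = T := by
  refine h.eq_of_not_conflict fun c hc => ?_
  rw [eq_of_mem_flipping_none_zero hx (hT hc)]
  exact not_orient_parabola_pos_of_lt (hx (by omega)) (hx (by omega))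

theorem legalize_hull_end (hx : StrictAnti x) {n j f : ℕ} {T T' : Mesh}
    (hT : T ⊆ Flipping x (n + 1) j)
    (h : Legalize (parabola (x (n + 2))) T none (vertex x (n + 1)) f T') : T' = T := by
  refine h.eq_of_not_conflict fun c hc => ?_
  rw [eq_of_mem_flipping_last_none hx (hT hc)]
  exact not_orient_parabola_pos_of_lt (hx (by omega)) (hx (by omega))

theorem legalize_hull_edge (hx : StrictAnti x) {n j i f : ℕ} {T T' : Mesh} (hj : j ≤ n)
    (hi : i < j ∨ i = n) (hT : T ⊆ Flipping x (n + 1) j)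
    (h : Legalize (parabola (x (n + 2))) T (vertex x (i + 1)) (vertex x i) f T') : T' = T := by
  refine h.eq_of_not_conflict fun c hc => ?_
  rw [eq_of_mem_flipping_edge hx (by omega) (by omega) (hT hc)]
  exact not_orient_parabola_pos_of_lt (hx (by omega)) (hx (by omega))

theorem conflict_flipping (hx : StrictAnti x) (h0 : ∀ i, 0 < x i) {n j : ℕ} (hj : j < n) :
    Conflict (vertex x j, vertex x (n + 1), vertex x (j + 1)) (parabola (x (n + 2))) := by
  have h1 : x (n + 2) < x (n + 1) := hx (by omega)
  have h2 : x (n + 1) < x (j + 1) := hx (by omega)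
  have h3 : x (j + 1) < x j := hx (by omega)
  simp only [vertex, Conflict, inCircle_parabola]
  refine mul_pos (mul_pos (mul_pos_of_neg_of_neg ?_ ?_ |> fun h => mul_pos h ?_) ?_) ?_
  · linarith
  · linarith
  · linarith
  · exact mul_pos (mul_pos (by linarith) (by linarith)) (by linarith)
  · linarith [h0 j, h0 (j + 1), h0 (n + 1), h0 (n + 2)]

/-- Each flip moves the critical edge from `x j` to `x (j + 1)`. The cascade stops at `j = n`, where
that edge is a hull edge. -/
theorem legalize_flipping (hx : StrictAnti x) (h0 : ∀ i, 0 < x i) {n j f : ℕ} {T T' : Mesh}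
    (hj : j ≤ n) (hT : T ⊆ Flipping x (n + 1) j)
    (h : Legalize (parabola (x (n + 2))) T (vertex x (n + 1)) (vertex x j) f T') :
    T' ⊆ Flipping x (n + 1) n ∧ n ≤ f + j := by
  induction hd : n - j generalizing j f T T' with
  | zero =>
    obtain rfl : j = n := by omega
    rw [legalize_hull_edge hx hj (.inr rfl) hT h]
    exact ⟨hT, by omega⟩
  | succ d ih =>
    have hjn : j < n := by omega
    cases h with
    | valid h1 h2 =>
      rw [eq_of_mem_flipping_inside hx (by omega) (hT h1)] at h2
      exact absurd (conflict_flipping hx h0 hjn) h2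
    | flip h1 h2 h3 h4 =>
      obtain rfl := eq_of_mem_flipping_inside hx (by omega) (hT h1)
      obtain ⟨h5, h6⟩ := ih (by omega) (flipEdge_flipping_subset hT) h3 (by omega)
      -- The second recursive call meets a hull edge and changes nothing.
      rw [legalize_hull_edge hx le_rfl (.inl hjn) h5 h4]
      exact ⟨h5, by omega⟩

theorem mem_cyc_of_contains (hx : StrictAnti x) {n : ℕ} {t : Triangle} (ht : t ∈ Fan x n)
    (hp : Contains t (parabola (x (n + 1)))) : t ∈ cyc (vertex x n) (vertex x 0) none := by
  rcases ht with ⟨i, h, ht⟩ | ⟨i, h, ht⟩ | ht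
  · exfalso
    have h1 := not_orient_parabola_pos_of_lt (hx (show n < n + 1 by omega)) (hx h.le)
    rcases ht with rfl | rfl | rfl
    · exact h1 hp.2.2
    · exact h1 hp.2.1
    · exact h1 hp.1
  · exfalso
    have h2 := not_orient_parabola_pos_of_lt (hx (show i + 1 < n + 1 by omega)) (hx i.lt_succ_self)
    rcases ht with rfl | rfl | rfl <;> exact h2 hp
  · exact ht

/-- The walk matters only through its final triangle, which must be the region beyond the chord from
the last point to the first. -/
theorem insertion_fan (hx : StrictAnti x) (h0 : ∀ i, 0 < x i) {n m f : ℕ} {T T' : Mesh} {q : Plane}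
    (hT : T ⊆ Fan x (n + 1)) (h : Insertion T q (parabola (x (n + 2))) m f T') :
    T' ⊆ Fan x (n + 2) ∧ n ≤ f := by
  obtain ⟨a, b, c, T₁, T₂, f₁, f₂, f₃, hw, hc, h1, h2, h3, rfl⟩ := h
  have hs := split_fan_subset hT
  -- The three listings of that region only permute the order in which the chord and the two
  -- unbounded edges are legalized.
  rcases mem_cyc_of_contains hx (hT hw.mem) hc with h | h | h <;>
    obtain ⟨rfl, rfl, rfl⟩ : a = _ ∧ b = _ ∧ c = _ := by simpa only [Set.mem_singleton_iff, Prod.mk.injEq] using h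
  · obtain ⟨h4, h5⟩ := legalize_flipping hx h0 n.zero_le hs h1
    obtain rfl := legalize_hull_start hx h4 h2
    obtain rfl := legalize_hull_end hx h4 h3
    exact ⟨h4.trans (flipping_subset_fan n), by omega⟩
  · rw [split_rotate] at h1
    obtain rfl := legalize_hull_start hx hs h1
    obtain rfl := legalize_hull_end hx hs h2
    obtain ⟨h4, h5⟩ := legalize_flipping hx h0 n.zero_le hs h3
    exact ⟨h4.trans (flipping_subset_fan n), by omega⟩
  · rw [split_rotate, split_rotate] at h1
    obtain rfl := legalize_hull_end hx hs h1
    obtain ⟨h4, h5⟩ := legalize_flipping hx h0 n.zero_le hs h2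
    obtain rfl := legalize_hull_start hx h4 h3
    exact ⟨h4.trans (flipping_subset_fan n), by omega⟩

theorem add_le_of_insertsWithin (hx : StrictAnti x) (h0 : ∀ i, 0 < x i) {k n l : ℕ} {T : Mesh}
    {q : Plane} (hT : T ⊆ Fan x (n + 1))
    (h : InsertsWithin k T q ((List.range' (n + 2) (l + 1)).map fun i => parabola (x i))) :
    n + l ≤ k := by
  induction l generalizing n T q with
  | zero =>
    obtain ⟨m, f, T', hi, -, hf, -⟩ := h
    exact (insertion_fan hx h0 hT hi).2.trans hf
  | succ l ih =>
    obtain ⟨m, f, T', hi, -, hf, h⟩ := h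
    have := ih (insertion_fan hx h0 hT hi).1 h
    omega

/-- The first `n` points of a sequence on the parabola. -/
def parabolaPrefix (x : ℕ → ℝ) (n : ℕ) : List Plane := ((List.range n).map x).map parabola

/-- The last of `l + 3` points has index `l + 2` and costs at least `l` flips. -/
theorem le_of_dLinear_parabolaPrefix (hx : StrictAnti x) (h0 : ∀ i, 0 < x i) {k n : ℕ}
    (h : DLinear k (parabolaPrefix x n)) : n ≤ k + 3 := by
  match n with
  | 0 | 1 | 2 => omega
  | l + 3 =>
    have := add_le_of_insertsWithin hx h0 (k := k) (n := 0) (l := l) (q := parabola (x 1))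
      initialMesh_subset_fan
      (by simpa [parabolaPrefix, List.range_eq_range', List.range'_succ, DLinear,
        Function.comp_def] using h)
    omega

end Decreasing

/-! ### Test-and-divide partitioning -/

theorem testAndDivide_length_le (k : ℕ) {S : List Plane} (hS : S ≠ []) :
    (testAndDivide k S).length ≤ S.length := by
  induction hn : S.length using Nat.strong_induction_on generalizing S with
  | _ n ih =>
    rw [testAndDivide]
    have := List.length_pos_iff.2 hS
    split_ifs with h
    · simp; omega
    · have h2 : ¬ S.length ≤ 1 := fun h' => h (DLinear.of_length_le_one h')
      have h3 := ih (S.take (S.length / 2)).length (by simp; omega)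
        (List.length_pos_iff.1 (by simp; omega)) rfl
      have h4 := ih (S.drop (S.length / 2)).length (by simp; omega)
        (List.length_pos_iff.1 (by simp; omega)) rfl
      simp only [List.length_append, List.length_take, List.length_drop] at *
      omega

theorem parabolaPrefix_take (x : ℕ → ℝ) (n m : ℕ) :
    (parabolaPrefix x n).take m = parabolaPrefix x (min m n) := by
  simp [parabolaPrefix, ← List.map_take, List.take_range]

theorem parabolaPrefix_drop (x : ℕ → ℝ) (n m : ℕ) :
    (parabolaPrefix x n).drop m = parabolaPrefix (fun i => x (m + i)) (n - m) := by
  apply List.ext_getElem <;> simp [parabolaPrefix]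

theorem parabolaPrefix_length (x : ℕ → ℝ) (n : ℕ) : (parabolaPrefix x n).length = n := by
  simp [parabolaPrefix]

/-- Both halves of a decreasing sequence are decreasing, hence the induction over all `x`. -/
theorem le_testAndDivide_parabolaPrefix (k : ℕ) {x : ℕ → ℝ} (hx : StrictAnti x)
    (h0 : ∀ i, 0 < x i) (n : ℕ) :
    n ≤ (k + 3) * (testAndDivide k (parabolaPrefix x n)).length := by
  induction n using Nat.strong_induction_on generalizing x with
  | _ n ih =>
    rw [testAndDivide]
    split_ifs with h
    · simpa using le_of_dLinear_parabolaPrefix hx h0 h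
    · have h2 : ¬ n ≤ 1 := fun h' =>
        h (DLinear.of_length_le_one (by rwa [parabolaPrefix_length]))
      rw [parabolaPrefix_length, parabolaPrefix_take, parabolaPrefix_drop, List.length_append,
        mul_add]
      have h3 := ih (min (n / 2) n) (by omega) hx h0
      have h4 := ih (n - n / 2) (by omega) (x := fun i => x (n / 2 + i))
        (fun i j hij => hx (by omega)) (fun i => h0 _)
      omega

/-! ### The sequence -/

theorem exists_maximal_dLinear_prefix (k : ℕ) {x : ℕ → ℝ} (hx : StrictAnti x)
    (h0 : ∀ i, 0 < x i) :
    ∃ m, 0 < m ∧ DLinear k (parabolaPrefix x m) ∧ ¬ DLinear k (parabolaPrefix x (m + 1)) := by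
  classical
  have h : ∃ m, ¬ DLinear k (parabolaPrefix x m) :=
    ⟨k + 4, fun h => by have := le_of_dLinear_parabolaPrefix hx h0 h; omega⟩
  have h1 : 1 < Nat.find h := by
    by_contra h1
    exact Nat.find_spec h (DLinear.of_length_le_one (by rw [parabolaPrefix_length]; omega))
  refine ⟨Nat.find h - 1, by omega, not_not.1 (Nat.find_min h (by omega)), ?_⟩
  rw [Nat.sub_add_cancel h1.le]
  exact Nat.find_spec h

/-- The abscissas: two decreasing sequences, the first one with the indices `0, …, m` and below
the second one. -/
noncomputable def abscissa (m i : ℕ) : ℝ := if i ≤ m then 1 / ((i : ℝ) + 1) else 1 + 1 / ((i : ℝ) + 1)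

theorem strictAnti_one_div_add_one : StrictAnti fun i : ℕ => 1 / ((i : ℝ) + 1) := by
  intro i j h
  have : (i : ℝ) < j := by exact_mod_cast h
  exact one_div_lt_one_div_of_lt (by positivity) (by linarith)

theorem one_div_add_one_le_one (i : ℕ) : 1 / ((i : ℝ) + 1) ≤ 1 := by
  rw [div_le_one (by positivity)]
  linarith [i.cast_nonneg (α := ℝ)]

theorem abscissa_lt {m i j : ℕ} (hi : i ≤ m) (hj : m < j) : abscissa m i < abscissa m j := by
  have h : (0 : ℝ) < 1 / ((j : ℝ) + 1) := by positivity
  rw [abscissa, if_pos hi, abscissa, if_neg (by omega)]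
  linarith [one_div_add_one_le_one i]

theorem abscissa_injective (m : ℕ) : Function.Injective (abscissa m) := by
  intro i j h
  by_cases hi : i ≤ m <;> by_cases hj : j ≤ m
  · rw [abscissa, if_pos hi, abscissa, if_pos hj] at h
    exact strictAnti_one_div_add_one.injective h
  · exact absurd h (abscissa_lt hi (by omega)).ne
  · exact absurd h (abscissa_lt hj (by omega)).ne'
  · rw [abscissa, if_neg hi, abscissa, if_neg hj, add_right_inj] at h
    exact strictAnti_one_div_add_one.injective h

theorem abscissa_pos (m i : ℕ) : 0 < abscissa m i := by
  unfold abscissa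
  split_ifs <;> positivity

theorem strictAnti_abscissa_add {m h : ℕ} (hm : m < h) :
    StrictAnti fun i => abscissa m (h + i) := by
  intro i j hij
  simp only [abscissa, if_neg (show ¬ h + i ≤ m by omega), if_neg (show ¬ h + j ≤ m by omega)]
  exact add_lt_add_right (strictAnti_one_div_add_one (show h + i < h + j by omega)) _

theorem parabolaPrefix_abscissa {m n : ℕ} (hn : n ≤ m + 1) :
    parabolaPrefix (abscissa m) n = parabolaPrefix (fun i => 1 / ((i : ℝ) + 1)) n := by
  refine congrArg (List.map parabola) (List.map_congr_left fun i hi => if_pos ?_)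
  have := List.mem_range.1 hi
  omega

/-- The second run starts at index `m`, with the minimum of the whole sequence; the points after it
decrease. -/
theorem dLinear_parabolaPrefix_abscissa_add (k m n : ℕ) :
    DLinear k (parabolaPrefix (fun i => abscissa m (m + i)) n) := by
  match n with
  | 0 => trivial
  | n + 1 =>
    rw [parabolaPrefix, List.range_succ_eq_map, List.map_cons]
    refine dLinear_cons_of_pairwise_gt (abscissa_pos _ _) ?_ ?_
    · rw [List.pairwise_map, List.pairwise_map]
      refine List.pairwise_lt_range.imp fun {i j} hij => ?_
      have := strictAnti_abscissa_add (m := m) m.lt_succ_self hij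
      simpa [add_assoc, add_comm, add_left_comm] using this
    · simp only [List.mem_map]
      rintro _ ⟨_, ⟨i, -, rfl⟩, rfl⟩
      exact abscissa_lt (by omega) (by omega)

theorem not_dLinear_parabolaPrefix_abscissa {k m n : ℕ}
    (h : ¬ DLinear k (parabolaPrefix (fun i => 1 / ((i : ℝ) + 1)) (m + 1))) (hn : m < n) :
    ¬ DLinear k (parabolaPrefix (abscissa m) n) := by
  intro h'
  rw [← List.take_append_drop (m + 1) (parabolaPrefix _ n), parabolaPrefix_take,
    min_eq_left (by omega), parabolaPrefix_abscissa le_rfl] at h'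
  exact h h'.of_append

theorem isRunPartition_abscissa {k m n : ℕ} (hm : 0 < m)
    (h : DLinear k (parabolaPrefix (fun i => 1 / ((i : ℝ) + 1)) m)) (hn : m < n) :
    IsRunPartition k (parabolaPrefix (abscissa m) n)
      [(parabolaPrefix (abscissa m) n).take m, (parabolaPrefix (abscissa m) n).drop m] := by
  refine ⟨by simp, fun R hR => ⟨?_, ?_⟩⟩
  · rw [← List.length_pos_iff]
    simp only [List.mem_cons, List.not_mem_nil, or_false] at hR
    rcases hR with rfl | rfl <;>
      simp only [List.length_take, List.length_drop, parabolaPrefix_length] <;> omega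
  · simp only [List.mem_cons, List.not_mem_nil, or_false] at hR
    rcases hR with rfl | rfl
    · rwa [parabolaPrefix_take, min_eq_left hn.le, parabolaPrefix_abscissa m.le_succ]
    · rw [parabolaPrefix_drop]
      exact dLinear_parabolaPrefix_abscissa_add k m _

theorem IsRunPartition.two_le_length {k : ℕ} {S : List Plane} {P : List (List Plane)}
    (hP : IsRunPartition k S P) (hS : ¬ DLinear k S) : 2 ≤ P.length := by
  match P, hP with
  | [], hP => exact absurd (DLinear.of_length_le_one (by simp [← hP.1])) hS
  | [R], hP =>
    refine absurd ?_ hS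
    rw [← hP.1, List.flatten_singleton]
    exact (hP.2 R (by simp)).2
  | _ :: _ :: _, _ => simp

/-- The second half starts past index `m`, so it is decreasing. It has at least `n / 2` points,
which accounts for the factor `2`. -/
theorem le_testAndDivide_abscissa {k m n : ℕ}
    (h : ¬ DLinear k (parabolaPrefix (abscissa m) n)) (hn : m < n / 2) :
    n ≤ 2 * (k + 3) * (testAndDivide k (parabolaPrefix (abscissa m) n)).length := by
  rw [testAndDivide, dif_neg h, parabolaPrefix_length, List.length_append, parabolaPrefix_drop]
  have := le_testAndDivide_parabolaPrefix k (strictAnti_abscissa_add hn)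
    (fun i => abscissa_pos m _) (n - n / 2)
  rw [mul_assoc, mul_add (k + 3)]
  omega

end IncrementalDelaunay

open IncrementalDelaunay in
theorem mainTheorem7 (k : ℕ) (hk : 0 < k) :
    ∃ S : ℕ → List IncrementalDelaunay.Plane,
      (∀ n, (S n).length = n ∧ IncrementalDelaunay.GeneralPosition (S n)) ∧
      (fun n => ((IncrementalDelaunay.testAndDivide k (S n)).length : ℝ)) =Θ[atTop]
        (fun n => (n : ℝ)) ∧
      ∀ᶠ n in atTop,
        IsLeast {r : ℕ | ∃ P : List (List IncrementalDelaunay.Plane),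
          IncrementalDelaunay.IsRunPartition k (S n) P ∧ P.length = r} 2 := by
  obtain ⟨m, hm, h, h'⟩ := exists_maximal_dLinear_prefix k strictAnti_one_div_add_one
    (fun i => by positivity)
  refine ⟨parabolaPrefix (abscissa m), fun n => ⟨parabolaPrefix_length _ n, ?_⟩, ⟨?_, ?_⟩, ?_⟩
  · exact generalPosition_map_parabola (List.nodup_range.map (abscissa_injective m))
  · refine .of_bound 1 ?_
    filter_upwards [eventually_gt_atTop 0] with n hn
    have := testAndDivide_length_le k (S := parabolaPrefix (abscissa m) n)
      (List.length_pos_iff.1 (by rwa [parabolaPrefix_length]))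
    rw [parabolaPrefix_length] at this
    simpa using this
  · refine .of_bound (2 * (k + 3) : ℕ) ?_
    filter_upwards [eventually_ge_atTop (2 * m + 2)] with n hn
    have := le_testAndDivide_abscissa (m := m) (n := n)
      (not_dLinear_parabolaPrefix_abscissa h' (by omega)) (by omega)
    rw [Real.norm_natCast, Real.norm_natCast]
    exact_mod_cast this
  · filter_upwards [eventually_gt_atTop m] with n hn
    refine ⟨⟨_, isRunPartition_abscissa hm h hn, rfl⟩, ?_⟩
    rintro r ⟨P, hP, rfl⟩
    exact hP.two_le_length (not_dLinear_parabolaPrefix_abscissa h' hn)
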